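/- Let $R$ be a finite commutative ring with unity. Its quadratic unitary Cayley graph $\mathcal G_R=\mathrm{Cay}(R,T_R)$ has vertex set $R$, and distinct $u,v$ are adjacent iff $u-v\in T_R=Q_R\cup(-Q_R)$, where $Q_R=\{x^2 : x\in R^\times\}$. Call $R$ *mixed* if $R\cong R_0\times\cdots\times R_s$ for some $s\ge 0$, where each $R_i$ is a local ring with maximal ideal $M_i$, $|R_0|/|M_0|\equiv 3\pmod 4$ and $|R_i|/|M_i|\equiv 1\pmod 4$ for $1\le i\le s$. For a finite simple graph $G$ with set of symmetric arcs $\mathcal A(G)$, let $N_{ua}=\frac{1}{\sqrt{\deg u}}$ if the vertex $u$ is the head of the arc $a$ and $N_{ua}=0$ otherwise, let $S_{ab}=1$ if $a$ is the inverse arc of $b$ and $S_{ab}=0$ otherwise, and let $U=S(2N^*N-I)$ be the time evolution matrix of the Grover walk. The graph $G$ exhibits *perfect state transfer* if there are distinct vertices $u,v$, a time $\tau\in\{1,2,\dots\}$ and a complex number $\gamma$ with $|\gamma|=1$ such that $N^*\mathbf e_u$ and $N^*\mathbf e_v$ are distinct unit vectors and $U^\tau N^*\mathbf e_u=\gamma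 N^*\mathbf e_v$. **Theorem.** Among the mixed rings together with $\mathbb Z_6$, the only ring whose quadratic unitary Cayley graph exhibits perfect state transfer is $\mathbb Z_6$: if $R$ is mixed or $R\cong\mathbb Z_6$, then $\mathcal G_R$ exhibits perfect state transfer if and only if $R\cong\mathbb Z_6$. Here $\mathbb Z_6$ itself is not mixed, so $\mathcal G_R$ exhibits perfect state transfer for no mixed ring $R$; the graph $\mathcal G_{\mathbb Z_6}$ is the $6$-cycle, and it does exhibit perfect state transfer. -/

import Mathlib

open scoped Matrix

universe u

noncomputable section

namespace GroverWalk

variable {V : Type*} [Fintype V] [DecidableEq V] (G : SimpleGraph V) [DecidableRel G.Adj]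

/-- The boundary matrix `N`: rows are vertices, columns are symmetric arcs (`G.Dart`), and
`N u a = 1 / √(deg u)` if `u` is the head `a.snd` of the arc `a`, and `0` otherwise. -/
def boundary : Matrix V G.Dart ℂ :=
  Matrix.of fun u a => if u = a.snd then 1 / ((Real.sqrt (G.degree u : ℝ) : ℝ) : ℂ) else 0

/-- The shift matrix `S`: `S a b = 1` if `a` is the inverse arc of `b`, and `0` otherwise. -/
def shift : Matrix G.Dart G.Dart ℂ :=
  Matrix.of fun a b => if a = b.symm then 1 else 0

/-- The time evolution matrix `U = S (2 N* N - I)` of the Grover walk on `G`. -/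
def evolution : Matrix G.Dart G.Dart ℂ :=
  shift G * ((2 : ℂ) • ((boundary G)ᴴ * boundary G) - 1)

/-- A state is a vector on the symmetric arcs of Euclidean norm one. -/
def IsState (Φ : G.Dart → ℂ) : Prop :=
  star Φ ⬝ᵥ Φ = 1

/-- Perfect state transfer from the state `Φ` to the (distinct) state `Ψ` at time `τ`. -/
def StateTransfer (Φ Ψ : G.Dart → ℂ) (τ : ℕ) : Prop :=
  IsState G Φ ∧ IsState G Ψ ∧ Φ ≠ Ψ ∧
    ∃ γ : ℂ, ‖γ‖ = 1 ∧ (evolution G ^ τ) *ᵥ Φ = γ • Ψ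

/-- The vertex-type state `N* e_u`. -/
def vertexState (u : V) : G.Dart → ℂ :=
  (boundary G)ᴴ *ᵥ Pi.single u 1

/-- `G` exhibits perfect state transfer: for some vertex `u`, some other vertex `v` and some time
`τ ≥ 1`, it occurs from the vertex-type state of `u` to that of `v` at time `τ`. -/
def ExhibitsPST : Prop :=
  ∃ u v : V, u ≠ v ∧ ∃ τ : ℕ, 0 < τ ∧ StateTransfer G (vertexState G u) (vertexState G v) τ

end GroverWalk

/-- `Q_R`, the set of squares of units of `R`. -/
def unitSquares (R : Type*) [CommRing R] : Set R :=
  {x | ∃ u : Rˣ, x = (u : R) ^ 2}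

/-- `T_R = Q_R ∪ (-Q_R)`. -/
def signedUnitSquares (R : Type*) [CommRing R] : Set R :=
  unitSquares R ∪ {x | -x ∈ unitSquares R}

/-- The quadratic unitary Cayley graph `Cay(R, T_R)`: distinct `u`, `v` are adjacent iff
`u - v ∈ T_R`. (Mathlib's `circulantGraph` is the Cayley graph of any additive group with respect
to the symmetrization of the given set; `T_R` is already symmetric.) -/
def quadraticUnitaryCayleyGraph (R : Type*) [CommRing R] : SimpleGraph R :=
  SimpleGraph.circulantGraph (signedUnitSquares R)

instance (R : Type*) [CommRing R] : DecidableRel (quadraticUnitaryCayleyGraph R).Adj :=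
  Classical.decRel _

/-- The mixed hypothesis on a finite commutative ring `R`: it decomposes as `R_0 × ⋯ × R_s`
(`s ≥ 0`) with local rings `R_i` with maximal ideals `M_i` such that `|R_0| / |M_0| ≡ 3 (mod 4)`
and `|R_i| / |M_i| ≡ 1 (mod 4)` for `1 ≤ i ≤ s`. -/
def IsMixed (R : Type u) [CommRing R] : Prop :=
  ∃ (s : ℕ) (S : Fin (s + 1) → Type u) (_ : ∀ i, CommRing (S i)) (_ : ∀ i, IsLocalRing (S i)),
    Nonempty (R ≃+* (∀ i, S i)) ∧
    Nat.card (S 0) / Nat.card (IsLocalRing.maximalIdeal (S 0)) ≡ 3 [MOD 4] ∧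
    ∀ i, i ≠ 0 → Nat.card (S i) / Nat.card (IsLocalRing.maximalIdeal (S i)) ≡ 1 [MOD 4]

end

open Matrix

/-! The matrix `U` is built from the graph alone, so it commutes with every automorphism. Hence if
the state of `u` is transferred to that of `v`, each automorphism fixing `u` also fixes `v`. On a
Cayley graph of an abelian group the reflection `x ↦ 2u - x` fixes `u`, which forces `2(u - v) = 0`.
In a mixed ring all residue fields have odd order, so `2` is a unit and `u = v`: no spectral
computation is needed. As `2` is not a unit in `ZMod 6`, that ring is not mixed. For `ZMod 6` the
only unit square is `1`, so the graph is the 6-cycle. At degree 2 the Grover walk has no reflection: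
it pushes arcs around the cycle, and three steps carry a vertex state to the antipode. -/

namespace SimpleGraph

variable {V W : Type*} {G : SimpleGraph V} {H : SimpleGraph W}

/-- The equivalence of darts induced by a graph isomorphism. -/
def Iso.dartEquiv (e : G ≃g H) : G.Dart ≃ H.Dart where
  toFun := e.toHom.mapDart
  invFun := e.symm.toHom.mapDart
  left_inv a := by ext <;> simp [Hom.mapDart]
  right_inv a := by ext <;> simp [Hom.mapDart]

@[simp]
theorem Iso.dartEquiv_fst (e : G ≃g H) (a : G.Dart) : (e.dartEquiv a).fst = e a.fst := rfl

@[simp]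
theorem Iso.dartEquiv_snd (e : G ≃g H) (a : G.Dart) : (e.dartEquiv a).snd = e a.snd := rfl

theorem Iso.dartEquiv_symm_comm (e : G ≃g H) (a : G.Dart) :
    (e.dartEquiv a).symm = e.dartEquiv a.symm := rfl

theorem sum_dart_snd_eq [Fintype V] [DecidableEq V] [DecidableRel G.Adj] {M : Type*}
    [AddCommMonoid M] (F : V → V → M) (x : V) :
    ∑ b : G.Dart, (if x = b.snd then F b.fst b.snd else 0) =
      ∑ y ∈ G.neighborFinset x, F y x := by
  rw [← Finset.sum_filter]
  refine Finset.sum_bij (fun b _ => b.fst) ?_ ?_ ?_ ?_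
  · intro b hb
    obtain rfl : x = b.snd := by simpa using hb
    simpa using b.adj.symm
  · intro a ha b hb hab
    have h₁ : x = a.snd := by simpa using ha
    have h₂ : x = b.snd := by simpa using hb
    exact Dart.ext _ _ (Prod.ext hab (h₁.symm.trans h₂))
  · intro y hy
    have hy : G.Adj x y := by simpa using hy
    exact ⟨⟨(y, x), hy.symm⟩, by simp, rfl⟩
  · intro b hb
    have h : x = b.snd := by simpa using hb
    rw [h]

end SimpleGraph

/-! ### Invariance of the walk under graph isomorphisms -/

namespace GroverWalk

theorem shift_submatrix {V W : Type*} [DecidableEq V] [DecidableEq W] {G : SimpleGraph V}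
    {H : SimpleGraph W} (e : G ≃g H) :
    (shift H).submatrix e.dartEquiv e.dartEquiv = shift G := by
  ext a b
  simp [shift, e.dartEquiv_symm_comm]

section Iso

variable {V W : Type*} [Fintype V] [DecidableEq V] [Fintype W] [DecidableEq W]
  {G : SimpleGraph V} {H : SimpleGraph W} [DecidableRel G.Adj] [DecidableRel H.Adj]

theorem boundary_submatrix (e : G ≃g H) :
    (boundary H).submatrix e e.dartEquiv = boundary G := by
  ext u a
  simp [boundary, e.degree_eq]

theorem conjTranspose_boundary_mul_boundary_submatrix (e : G ≃g H) :
    ((boundary H)ᴴ * boundary H).submatrix e.dartEquiv e.dartEquiv =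
      (boundary G)ᴴ * boundary G := by
  rw [← Matrix.submatrix_mul_equiv _ _ _ e.toEquiv, ← boundary_submatrix e]
  rfl

theorem evolution_submatrix (e : G ≃g H) :
    (evolution H).submatrix e.dartEquiv e.dartEquiv = evolution G := by
  unfold evolution
  rw [← Matrix.submatrix_mul_equiv _ _ _ e.dartEquiv, shift_submatrix, Matrix.submatrix_sub,
    Matrix.submatrix_smul, Pi.sub_apply, Pi.sub_apply, Matrix.submatrix_one_equiv]
  rw [Pi.smul_apply, Pi.smul_apply, conjTranspose_boundary_mul_boundary_submatrix]

theorem evolution_pow_submatrix (e : G ≃g H) (τ : ℕ) :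
    (evolution H ^ τ).submatrix e.dartEquiv e.dartEquiv = evolution G ^ τ := by
  induction τ with
  | zero => simp
  | succ k ih =>
    rw [pow_succ, pow_succ, ← Matrix.submatrix_mul_equiv _ _ _ e.dartEquiv, ih,
      evolution_submatrix]

theorem vertexState_apply (u : V) (a : G.Dart) :
    vertexState G u a =
      if u = a.snd then 1 / ((Real.sqrt (G.degree u : ℝ) : ℝ) : ℂ) else 0 := by
  unfold vertexState
  rw [Matrix.mulVec_single_one]
  simp only [Matrix.col_apply, Matrix.conjTranspose_apply, boundary, Matrix.of_apply]
  split_ifs <;> simp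

theorem vertexState_comp (e : G ≃g H) (u : V) :
    vertexState H (e u) ∘ e.dartEquiv = vertexState G u := by
  ext a
  simp [vertexState_apply, e.degree_eq]

theorem evolution_pow_mulVec_comp (e : G ≃g H) (τ : ℕ) (Φ : H.Dart → ℂ) :
    (evolution G ^ τ) *ᵥ (Φ ∘ e.dartEquiv) = ((evolution H ^ τ) *ᵥ Φ) ∘ e.dartEquiv := by
  rw [← evolution_pow_submatrix e, Matrix.submatrix_mulVec_equiv]
  congr 2
  ext a
  simp

theorem StateTransfer.comp {Φ Ψ : H.Dart → ℂ} {τ : ℕ} (h : StateTransfer H Φ Ψ τ)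
    (e : G ≃g H) : StateTransfer G (Φ ∘ e.dartEquiv) (Ψ ∘ e.dartEquiv) τ := by
  obtain ⟨h₁, h₂, hne, γ, hγ, h⟩ := h
  refine ⟨?_, ?_, ?_, γ, hγ, ?_⟩
  · exact (comp_equiv_dotProduct_comp_equiv (star Φ) Φ e.dartEquiv).trans h₁
  · exact (comp_equiv_dotProduct_comp_equiv (star Ψ) Ψ e.dartEquiv).trans h₂
  · exact fun h => hne (e.dartEquiv.surjective.injective_comp_right h)
  · rw [evolution_pow_mulVec_comp, h]
    rfl

theorem ExhibitsPST.of_iso (h : ExhibitsPST H) (e : G ≃g H) : ExhibitsPST G := by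
  obtain ⟨u, v, huv, τ, hτ, h⟩ := h
  refine ⟨e.symm u, e.symm v, fun h => huv (e.symm.injective h), τ, hτ, ?_⟩
  rw [← vertexState_comp e, ← vertexState_comp e, e.apply_symm_apply, e.apply_symm_apply]
  exact h.comp e

/-- A vertex state is supported on the arcs with that head. Unit norm rules out the zero state of an
isolated vertex. -/
theorem vertexState_injective_of_isState {v w : V} (hv : IsState G (vertexState G v))
    (h : vertexState G v = vertexState G w) : v = w := by
  obtain ⟨a, ha⟩ : ∃ a, vertexState G v a ≠ 0 := by
    by_contra! h0
    have h0 : vertexState G v = 0 := funext h0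
    simp [IsState, h0] at hv
  have hw : vertexState G w a ≠ 0 := h ▸ ha
  rw [vertexState_apply] at ha hw
  exact (ite_ne_right_iff.1 ha).1.trans (ite_ne_right_iff.1 hw).1.symm

/-- A vertex receiving perfect state transfer from `u` is fixed by every automorphism fixing `u`. -/
theorem StateTransfer.fixed_of_fixed {u v : V} {τ : ℕ}
    (h : StateTransfer G (vertexState G u) (vertexState G v) τ) (e : G ≃g G) (hu : e u = u) :
    e v = v := by
  have hcomp (w : V) : vertexState G w ∘ e.symm.dartEquiv = vertexState G (e w) := by
    rw [← vertexState_comp e.symm (e w)]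
    exact congrArg (vertexState G · ∘ e.symm.dartEquiv) (e.symm_apply_apply w).symm
  obtain ⟨-, hv, -, γ, hγ, h⟩ := h
  -- Relabelling by `e` leaves the source state unchanged and turns the target state of `v` into
  -- that of `e v`.
  have h' := evolution_pow_mulVec_comp e.symm τ (vertexState G u)
  rw [hcomp, hu, h] at h'
  have hγ₀ : γ ≠ 0 := norm_ne_zero_iff.1 (hγ ▸ one_ne_zero)
  refine (vertexState_injective_of_isState hv (smul_right_injective _ hγ₀ ?_)).symm
  rw [← hcomp]
  exact h'

end Iso

/-- `N*N` averages over arcs with a common head and `S` reverses arcs. Taking `F` on all pairs of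
vertices allows evaluation without adjacency proofs. -/
theorem evolution_mulVec_apply {V : Type*} [Fintype V] [DecidableEq V] (G : SimpleGraph V)
    [DecidableRel G.Adj] (F : V → V → ℂ) (a : G.Dart) :
    (evolution G *ᵥ fun b => F b.fst b.snd) a =
      2 / (G.degree a.fst : ℂ) * ∑ y ∈ G.neighborFinset a.fst, F y a.fst - F a.snd a.fst := by
  have hshift (Φ : G.Dart → ℂ) : (shift G *ᵥ Φ) a = Φ a.symm := by
    simp only [shift, Matrix.mulVec, dotProduct, Matrix.of_apply]
    rw [Finset.sum_eq_single a.symm] <;> simp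
    intro b hb h
    exact absurd (by rw [h, SimpleGraph.Dart.symm_symm]) hb
  have hproj (b : G.Dart) : ((boundary G)ᴴ * boundary G) a.symm b =
      if a.fst = b.snd then 1 / (G.degree a.fst : ℂ) else 0 := by
    have hd : ((Real.sqrt (G.degree a.fst : ℝ) : ℝ) : ℂ) *
        ((Real.sqrt (G.degree a.fst : ℝ) : ℝ) : ℂ) = G.degree a.fst := by
      rw [← Complex.ofReal_mul, Real.mul_self_sqrt (Nat.cast_nonneg _), Complex.ofReal_natCast]
    simp only [Matrix.mul_apply, Matrix.conjTranspose_apply, boundary, Matrix.of_apply]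
    rw [Finset.sum_eq_single a.fst]
    · rw [if_pos (show a.fst = a.symm.snd from rfl)]
      split_ifs <;> simp [← mul_inv, hd]
    · intro c _ hc
      simp [hc]
    · simp
  rw [evolution, ← Matrix.mulVec_mulVec, hshift, Matrix.sub_mulVec, Matrix.smul_mulVec,
    Matrix.one_mulVec, Pi.sub_apply, Pi.smul_apply]
  have hsum : (((boundary G)ᴴ * boundary G) *ᵥ fun b => F b.fst b.snd) a.symm =
      1 / (G.degree a.fst : ℂ) * ∑ y ∈ G.neighborFinset a.fst, F y a.fst := by
    rw [← SimpleGraph.sum_dart_snd_eq, Finset.mul_sum]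
    simp only [Matrix.mulVec, dotProduct, hproj]
    exact Finset.sum_congr rfl fun b _ => by split_ifs <;> simp
  rw [hsum, smul_eq_mul, ← mul_assoc, mul_one_div]
  rfl

end GroverWalk

open GroverWalk

/-! ### No transfer on mixed rings -/

/-- The point reflection `x ↦ 2 c - x` as an automorphism of a circulant graph. -/
def SimpleGraph.circulantGraphReflection {A : Type*} [AddCommGroup A] (s : Set A) (c : A) :
    circulantGraph s ≃g circulantGraph s where
  toEquiv := Equiv.subLeft (c + c)
  map_rel_iff' {a b} := by
    simp only [circulantGraph_adj, Equiv.subLeft_apply, sub_sub_sub_cancel_left, sub_right_inj]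
    rw [or_comm]

theorem add_self_eq_zero_of_stateTransfer {A : Type*} [AddCommGroup A] [Fintype A]
    [DecidableEq A] (s : Set A) [DecidableRel (SimpleGraph.circulantGraph s).Adj] {u v : A} {τ : ℕ}
    (h : StateTransfer (SimpleGraph.circulantGraph s) (vertexState _ u) (vertexState _ v) τ) :
    (u - v) + (u - v) = 0 := by
  have h := h.fixed_of_fixed (SimpleGraph.circulantGraphReflection s u)
    (add_sub_cancel_right u u)
  change u + u - v = v at h
  rw [sub_add_sub_comm, ← sub_sub, h, sub_self]

/-- If `2` lay in the maximal ideal, `1` would have additive order 2 in the residue field, whose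
order would then be even. -/
theorem IsLocalRing.isUnit_two_of_odd {S : Type*} [CommRing S] [IsLocalRing S]
    (h : Odd (Nat.card S / Nat.card (IsLocalRing.maximalIdeal S))) : IsUnit (2 : S) := by
  by_contra h2
  have h2 : (2 : S) ∈ maximalIdeal S := h2
  have hcard := (maximalIdeal S).card_eq_card_quotient_mul_card
  -- An infinite ideal has `Nat.card` zero; the quotient is then `0`, which is not odd.
  rcases Nat.eq_zero_or_pos (Nat.card (maximalIdeal S)) with h0 | h0
  · rw [h0, Nat.div_zero] at h
    exact absurd h (by decide)
  rw [hcard, Nat.mul_div_cancel_left _ h0] at h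
  have h1 : addOrderOf (1 : S ⧸ maximalIdeal S) = 2 := by
    refine addOrderOf_eq_prime ?_ one_ne_zero
    rw [nsmul_one]
    exact_mod_cast Ideal.Quotient.eq_zero_iff_mem.2 h2
  exact Nat.not_even_iff_odd.2 h (even_iff_two_dvd.2 (h1 ▸ addOrderOf_dvd_natCard _))

theorem IsMixed.isUnit_two {R : Type u} [CommRing R] (h : IsMixed R) : IsUnit (2 : R) := by
  obtain ⟨s, S, _, _, ⟨e⟩, h₀, h₁⟩ := h
  have h2 : IsUnit (2 : ∀ i, S i) := by
    rw [Pi.isUnit_iff]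
    intro i
    refine IsLocalRing.isUnit_two_of_odd (Nat.odd_iff.2 ?_)
    by_cases hi : i = 0
    · subst hi
      unfold Nat.ModEq at h₀
      omega
    · have := h₁ i hi
      unfold Nat.ModEq at this
      omega
  exact map_ofNat e.symm 2 ▸ h2.map e.symm

theorem IsMixed.isEmpty_ringEquiv_zmod_six {R : Type u} [CommRing R] (h : IsMixed R) :
    IsEmpty (R ≃+* ZMod 6) := by
  refine ⟨fun e => ?_⟩
  have h2 : IsUnit (2 : ZMod 6) := map_ofNat e 2 ▸ h.isUnit_two.map e
  exact absurd (h2.mul_left_cancel (b := 3) (c := 0) (by decide)) (by decide)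

theorem IsMixed.not_exhibitsPST {R : Type u} [CommRing R] [Fintype R] [DecidableEq R]
    (h : IsMixed R) : ¬ ExhibitsPST (quadraticUnitaryCayleyGraph R) := by
  rintro ⟨u, v, huv, τ, -, hst⟩
  have : DecidableRel (SimpleGraph.circulantGraph (signedUnitSquares R)).Adj :=
    Classical.decRel _
  have h0 := add_self_eq_zero_of_stateTransfer (signedUnitSquares R)
    (by convert hst; rfl)
  rw [← two_mul] at h0
  exact huv (sub_eq_zero.1 (h.isUnit_two.mul_right_eq_zero.1 h0))

/-! ### Ring isomorphisms and the case of `ZMod 6` -/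

theorem RingEquiv.map_mem_signedUnitSquares {R S : Type*} [CommRing R] [CommRing S]
    (e : R ≃+* S) {x : R} (hx : x ∈ signedUnitSquares R) : e x ∈ signedUnitSquares S := by
  rcases hx with ⟨w, hw⟩ | ⟨w, hw⟩
  · exact Or.inl ⟨Units.map e.toMonoidHom w, by simp [hw]⟩
  · exact Or.inr ⟨Units.map e.toMonoidHom w, by simp [← map_neg, hw]⟩

/-- The graph isomorphism induced by a ring isomorphism. -/
def RingEquiv.quadraticUnitaryCayleyGraphIso {R S : Type*} [CommRing R] [CommRing S]
    (e : R ≃+* S) : quadraticUnitaryCayleyGraph R ≃g quadraticUnitaryCayleyGraph S where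
  toEquiv := e.toEquiv
  map_rel_iff' {a b} := by
    have hmem (x : R) : e x ∈ signedUnitSquares S ↔ x ∈ signedUnitSquares R :=
      ⟨fun h => by simpa using e.symm.map_mem_signedUnitSquares h, e.map_mem_signedUnitSquares⟩
    simp [quadraticUnitaryCayleyGraph, SimpleGraph.circulantGraph_adj, ← map_sub, hmem]

theorem mem_signedUnitSquares_zmod_six (x : ZMod 6) :
    x ∈ signedUnitSquares (ZMod 6) ↔ x = 1 ∨ x = -1 := by
  have hsq : ∀ w : (ZMod 6)ˣ, (w : ZMod 6) ^ 2 = 1 := by decide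
  constructor
  · rintro (⟨w, hw⟩ | ⟨w, hw⟩)
    · exact Or.inl (hw.trans (hsq w))
    · exact Or.inr (neg_eq_iff_eq_neg.1 (hw.trans (hsq w)))
  · rintro (rfl | rfl)
    · exact Or.inl ⟨1, by simp⟩
    · exact Or.inr ⟨1, by simp⟩

theorem quadraticUnitaryCayleyGraph_zmod_six_adj (x y : ZMod 6) :
    (quadraticUnitaryCayleyGraph (ZMod 6)).Adj x y ↔ x - y = 1 ∨ y - x = 1 := by
  simp only [quadraticUnitaryCayleyGraph, SimpleGraph.circulantGraph_adj,
    mem_signedUnitSquares_zmod_six]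
  revert x y
  decide

/-- The quadratic unitary Cayley graph of `ZMod 6` is the 6-cycle. -/
def quadraticUnitaryCayleyGraphZModSixIso :
    quadraticUnitaryCayleyGraph (ZMod 6) ≃g SimpleGraph.cycleGraph 6 where
  toEquiv := Equiv.refl (Fin 6)
  map_rel_iff' {a b} :=
    SimpleGraph.cycleGraph_adj.trans (quadraticUnitaryCayleyGraph_zmod_six_adj a b).symm

theorem neighborFinset_zmod_six (x : ZMod 6) :
    (quadraticUnitaryCayleyGraph (ZMod 6)).neighborFinset x = {x - 1, x + 1} := by
  ext y
  rw [SimpleGraph.mem_neighborFinset, quadraticUnitaryCayleyGraph_zmod_six_adj]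
  revert x y
  decide

theorem degree_zmod_six (x : ZMod 6) :
    (quadraticUnitaryCayleyGraph (ZMod 6)).degree x = 2 := by
  rw [← SimpleGraph.card_neighborFinset_eq_degree, neighborFinset_zmod_six]
  revert x
  decide

/-- With `2 / deg = 1`, the subtracted term cancels one of the two neighbour terms; the arc left is
the one preceding `b` on the cycle. -/
theorem evolution_zmod_six_mulVec (F : ZMod 6 → ZMod 6 → ℂ) :
    (evolution (quadraticUnitaryCayleyGraph (ZMod 6)) *ᵥ fun b => F b.fst b.snd) =
      fun b => F (2 * b.fst - b.snd) b.fst := by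
  ext a
  have hne : ∀ x : ZMod 6, x - 1 ≠ x + 1 := by decide
  rw [evolution_mulVec_apply, degree_zmod_six, neighborFinset_zmod_six,
    Finset.sum_pair (hne _)]
  rcases (quadraticUnitaryCayleyGraph_zmod_six_adj _ _).1 a.adj with h | h
  · rw [show a.snd = a.fst - 1 by rw [← h]; ring,
      show 2 * a.fst - (a.fst - 1) = a.fst + 1 by ring]
    push_cast
    ring
  · rw [show a.snd = a.fst + 1 by rw [← h]; ring,
      show 2 * a.fst - (a.fst + 1) = a.fst - 1 by ring]
    push_cast
    ring

theorem isState_vertexState_zmod_six (u : ZMod 6) :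
    IsState (quadraticUnitaryCayleyGraph (ZMod 6)) (vertexState _ u) := by
  have h2 : (1 / ((Real.sqrt ((2 : ℕ) : ℝ) : ℝ) : ℂ)) * (1 / ((Real.sqrt ((2 : ℕ) : ℝ) : ℝ) : ℂ)) =
      1 / 2 := by
    rw [one_div_mul_one_div, ← Complex.ofReal_mul, Real.mul_self_sqrt (Nat.cast_nonneg _)]
    simp
  have hterm (a : (quadraticUnitaryCayleyGraph (ZMod 6)).Dart) :
      star (vertexState (quadraticUnitaryCayleyGraph (ZMod 6)) u) a * vertexState _ u a =
        if u = a.snd then (fun _ _ => 1 / 2 : ZMod 6 → ZMod 6 → ℂ) a.fst a.snd else 0 := by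
    rw [Pi.star_apply, vertexState_apply, degree_zmod_six, ← h2]
    split_ifs <;> simp
  rw [IsState, dotProduct]
  simp_rw [hterm]
  rw [SimpleGraph.sum_dart_snd_eq fun _ _ => (1 / 2 : ℂ), Finset.sum_const, SimpleGraph.card_neighborFinset_eq_degree,
    degree_zmod_six]
  norm_num

theorem exhibitsPST_zmod_six : ExhibitsPST (quadraticUnitaryCayleyGraph (ZMod 6)) := by
  have hstate (u : ZMod 6) : vertexState (quadraticUnitaryCayleyGraph (ZMod 6)) u =
      fun b => (fun _ y => if u = y then 1 / ((Real.sqrt ((2 : ℕ) : ℝ) : ℝ) : ℂ) else 0 :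
        ZMod 6 → ZMod 6 → ℂ) b.fst b.snd := by
    ext b
    rw [vertexState_apply, degree_zmod_six]
  have h03 : (0 : ZMod 6) ≠ 3 := by decide
  refine ⟨0, 3, h03, 3, by norm_num, isState_vertexState_zmod_six 0,
    isState_vertexState_zmod_six 3,
    fun h => h03 (vertexState_injective_of_isState (isState_vertexState_zmod_six 0) h),
    1, norm_one, ?_⟩
  have hcube (F : ZMod 6 → ZMod 6 → ℂ) :
      (evolution (quadraticUnitaryCayleyGraph (ZMod 6)) ^ 3 *ᵥ fun b => F b.fst b.snd) =
        fun b => F (2 * (2 * (2 * b.fst - b.snd) - b.fst) - (2 * b.fst - b.snd))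
          (2 * (2 * b.fst - b.snd) - b.fst) := by
    rw [pow_succ, pow_succ, pow_one, ← Matrix.mulVec_mulVec, evolution_zmod_six_mulVec F,
      ← Matrix.mulVec_mulVec, evolution_zmod_six_mulVec fun x y => F (2 * x - y) x,
      evolution_zmod_six_mulVec fun x y => F (2 * (2 * x - y) - x) (2 * x - y)]
  rw [hstate 0,
    hcube fun _ y => if 0 = y then 1 / ((Real.sqrt ((2 : ℕ) : ℝ) : ℝ) : ℂ) else 0, one_smul, hstate 3]
  ext b
  -- Three pullbacks turn the head `y` into `3x - 2y`, which is `y + 3` when `y = x ± 1`.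
  have hiff : ∀ x y : ZMod 6, (x - y = 1 ∨ y - x = 1) →
      (0 = 2 * (2 * x - y) - x ↔ 3 = y) := by decide
  simp only [hiff _ _ ((quadraticUnitaryCayleyGraph_zmod_six_adj _ _).1 b.adj)]

theorem theorem5p9 :
    (∀ (R : Type u) [CommRing R] [Fintype R] [DecidableEq R],
      (IsMixed R ∨ Nonempty (R ≃+* ZMod 6)) →
        (GroverWalk.ExhibitsPST (quadraticUnitaryCayleyGraph R) ↔ Nonempty (R ≃+* ZMod 6))) ∧
    (∀ (R : Type u) [CommRing R] [Fintype R] [DecidableEq R],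
      IsMixed R → ¬ GroverWalk.ExhibitsPST (quadraticUnitaryCayleyGraph R)) ∧
    ¬ IsMixed (ZMod 6) ∧
    GroverWalk.ExhibitsPST (quadraticUnitaryCayleyGraph (ZMod 6)) ∧
    Nonempty (quadraticUnitaryCayleyGraph (ZMod 6) ≃g SimpleGraph.cycleGraph 6) := by
  refine ⟨fun R _ _ _ hR => ⟨fun h => ?_, fun ⟨e⟩ => ?_⟩, fun R _ _ _ h => h.not_exhibitsPST,
    fun h => h.isEmpty_ringEquiv_zmod_six.false (RingEquiv.refl _), exhibitsPST_zmod_six,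
    ⟨quadraticUnitaryCayleyGraphZModSixIso⟩⟩
  · exact hR.resolve_left fun hm => hm.not_exhibitsPST h
  · exact exhibitsPST_zmod_six.of_iso e.quadraticUnitaryCayleyGraphIso
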